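/- Consider a bandit with $N\ge 1$ independent arms. Arm $n$, if played at time $t\ge1$, yields a reward $X_n(t)$; for each $n$ the rewards are i.i.d. in $t$ with a distribution $f_n$ that has a finite $p$-th absolute moment, where $p>1$ is real. All the $X_n(t)$ are independent. Put $\theta_n=\mathbb E[X_n(1)]$, $\theta^*=\max_n\theta_n$, $\Delta_{\max}=\theta^*-\min_n\theta_n$. The regret of a policy $\pi$ (a measurable map from the history of decisions and observed rewards to the next arm) is $R_T=T\theta^*-\mathbb E\big[\sum_{t=1}^T X_{\pi}(t)\big]$, where $X_\pi(t)$ is the reward obtained at time $t$. Choose a constant $v>0$ and put $\alpha=1/p$ if $1<p\le 2$, $\alpha=1/(1+p/2)$ if $p>2$. Let $\mathcal A$ be a set of (exploration) times such that each $t>1$ belongs to $\mathcal A$ if and only if $|\mathcal A(t-1)|<v\,t^{\alpha}$, where $\mathcal A(t)=\mathcal A\cap\{1,\dots,t\}$; whether $1\in\mathcal A$ does not matter. The policy DSEE (Deterministic Sequencing of Exploration and Exploitation) with exploration sequence $\mathcal A$ plays, at a time $t\in\mathcal A$, arm $((|\mathcal A(t)|-1)\bmod N)+1$ and, at a time $t\notin\mathcal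 A$, an arm with the largest sample mean, computed from the rewards observed at the times in $\mathcal A(t-1)$; ties are broken in any way, and any arm may be played while some arm has no such observation. Then, as $T\to\infty$, $R_T=O(T^{1/p})$ if $1<p\le2$ and $R_T=O(T^{1/(1+p/2)})$ if $p>2$. Moreover, let $d>0$ be such that every arm with $\theta_n<\theta^*$ has $\theta^*-\theta_n\ge d$, and put $C=(3\sqrt2)^p\,p^{p/2}\,(d/2)^{-p}\sum_{n=1}^N\mathbb E\big[|X_n(1)-\theta_n|^p\big]$. Then for every $T\ge1$ $$R_T\le \Delta_{\max}\,C\Big(\frac{2N}{v}\Big)^{p-1}\big[p\,(T^{1/p}-1)+1\big]+\Delta_{\max}\lceil vT^{1/p}\rceil+\Delta_{\max}\Big(1+\Big(\frac Nv\Big)^{p}\Big)\quad\text{if }1<p\le2,$$ $$R_T\le \Delta_{\max}\,C\Big(\frac{2N}{v}\Big)^{p/2}\Big[\Big(1+\frac p2\Big)\big(T^{\frac1{1+p/2}}-1\big)+1\Big]+\Delta_{\max}\big\lceil vT^{\frac1{1+p/2}}\big\rceil+\Delta_{\max}\Big(1+\Big(\frac Nv\Big)^{1+p/2}\Big)\quad\text{if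 }p>2.$$ -/

import Mathlib

open MeasureTheory ProbabilityTheory Filter Asymptotics

noncomputable section

namespace Bandit

/-- An arm selection policy for `N` arms (numbered `0, …, N - 1`). At time `t ≥ 1` it maps the
decision and observation history, i.e. the pairs (arm played, reward received) at the times
`1, …, t - 1`, to the arm to play at time `t`. -/
structure Policy (N : ℕ) where
  act : (t : ℕ) → (Finset.Ico 1 t → Fin N × ℝ) → Fin N
  measurable_act : ∀ t, Measurable (act t)

/-- The arm played at time `t` when policy `π` faces the reward table `x`
(`x n s` is the reward that arm `n` yields if it is played at time `s`). -/
def Policy.arm {N : ℕ} (π : Policy N) (x : Fin N → ℕ → ℝ) (t : ℕ) : Fin N :=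
  π.act t fun s => (π.arm x s, x (π.arm x s) s)
termination_by t
decreasing_by
  all_goals exact (Finset.mem_Ico.mp s.2).2

/-- `X n t` (`t ≥ 1`) are the rewards of a bandit with reward distributions `ν`: they are i.i.d.
over time with law `ν n` for arm `n`, and the arms are independent. The value `X n 0` plays no
role. -/
structure IsRewardProcess {N : ℕ} {Ω : Type*} [MeasurableSpace Ω] (μ : Measure Ω)
    (ν : Fin N → Measure ℝ) (X : Fin N → ℕ → Ω → ℝ) : Prop where
  measurable : ∀ n, ∀ t, 1 ≤ t → Measurable (X n t)
  law : ∀ n, ∀ t, 1 ≤ t → μ.map (X n t) = ν n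
  indep : iIndepFun (fun q : Fin N × ℕ+ => X q.1 (q.2 : ℕ)) μ

/-- The mean reward of arm `n`. -/
def armMean {N : ℕ} (ν : Fin N → Measure ℝ) (n : Fin N) : ℝ := ∫ x, x ∂(ν n)

/-- The largest mean reward of all arms. -/
def bestMean {N : ℕ} (ν : Fin N → Measure ℝ) : ℝ := ⨆ n, armMean ν n

/-- The gap between the largest mean reward and the mean reward of arm `n`. -/
def gap {N : ℕ} (ν : Fin N → Measure ℝ) (n : Fin N) : ℝ := bestMean ν - armMean ν n

/-- The largest gap, i.e. the difference between the best and the worst mean reward. -/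
def maxGap {N : ℕ} (ν : Fin N → Measure ℝ) : ℝ := ⨆ n, gap ν n

/-- The `p`-th absolute central moment of the reward of arm `n`. -/
def centralMomentAbs {N : ℕ} (ν : Fin N → Measure ℝ) (p : ℝ) (n : Fin N) : ℝ :=
  ∫ x, |x - armMean ν n| ^ p ∂(ν n)

/-- The regret of policy `π` over the horizon `T`. -/
def regret {N : ℕ} {Ω : Type*} [MeasurableSpace Ω] (μ : Measure Ω)
    (ν : Fin N → Measure ℝ) (X : Fin N → ℕ → Ω → ℝ) (π : Policy N) (T : ℕ) : ℝ :=
  T * bestMean ν -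
    ∫ ω, ∑ t ∈ Finset.Icc 1 T, X (π.arm (fun n s => X n s ω) t) t ω ∂μ

open Classical in
/-- The exploration times up to and including time `t`, for the set `A` of all
exploration times. -/
def explUpTo (A : Set ℕ) (t : ℕ) : Finset ℕ := (Finset.Icc 1 t).filter (· ∈ A)

/-- `A` is an exploration sequence built with the threshold `b`: a time `t > 1` is included exactly
when fewer than `b t` exploration times precede it. Whether time `1` is included is left open. -/
def IsExplorationSequence (b : ℕ → ℝ) (A : Set ℕ) : Prop :=
  ∀ t : ℕ, 1 < t → (t ∈ A ↔ ((explUpTo A (t - 1)).card : ℝ) < b t)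

open Classical in
/-- The times before `t` which belong to the exploration sequence `A` and at which,
according to the history `h`, arm `n` was played. -/
def explTimes {N : ℕ} (A : Set ℕ) {t : ℕ} (h : Finset.Ico 1 t → Fin N × ℝ) (n : Fin N) :
    Finset (Finset.Ico 1 t) :=
  Finset.univ.filter fun s => (s : ℕ) ∈ A ∧ (h s).1 = n

/-- The sample mean of arm `n` at time `t`, computed from the rewards observed at the
exploration times before `t`. It is meaningful only if there is such an observation. -/
def sampleMean {N : ℕ} (A : Set ℕ) {t : ℕ} (h : Finset.Ico 1 t → Fin N × ℝ) (n : Fin N) : ℝ :=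
  (∑ s ∈ explTimes A h n, (h s).2) / ((explTimes A h n).card : ℝ)

/-- `π` follows Deterministic Sequencing of Exploration and Exploitation with the exploration
sequence `A`: at exploration times the arms are played in a round-robin fashion, at all other times
an arm with the largest sample mean is played. Ties may be broken in any way, and so may the
choice as long as the sample mean of some arm is still undefined for lack of observations. -/
structure Policy.IsDSEE {N : ℕ} (π : Policy N) (A : Set ℕ) : Prop where
  explore : ∀ t : ℕ, 1 ≤ t → t ∈ A → ∀ h : Finset.Ico 1 t → Fin N × ℝ,
    (π.act t h : ℕ) = ((explUpTo A t).card - 1) % N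
  exploit : ∀ t : ℕ, 1 ≤ t → t ∉ A → ∀ h : Finset.Ico 1 t → Fin N × ℝ,
    (∀ n, (explTimes A h n).Nonempty) → ∀ m, sampleMean A h m ≤ sampleMean A h (π.act t h)

/-- The growth exponent of the exploration sequence. -/
def explExponent (p : ℝ) : ℝ := if p ≤ 2 then 1 / p else 1 / (1 + p / 2)

end Bandit

end

/-!
The regret is the sum over time of the expected gap of the arm played, because the reward of an arm
at time `t` is independent of the history that selects the arm (`Bandit.regret_eq_sum_integral_gap`).
The times up to `T` are split into three kinds.

* Exploration times. There are at most `⌈v T ^ α⌉` of them (`Bandit.card_explUpTo_le`), and each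
  costs at most the largest gap.
* The time `1`, and the times with `v t ^ α < N`, when some arm may lack observations. There are at
  most `1 + (N / v) ^ (1 / α)` of them (`Bandit.card_filter_eq_one_or_lt_le`).
* The remaining exploitation times. Since `t` was not chosen for exploration, at least `v t ^ α`
  exploration times precede it, so the round robin has explored each arm at least `v t ^ α / (2 N)`
  times (`Bandit.le_card_armExplUpTo`). The exploration times are deterministic, so the sample means
  are averages of a fixed number of i.i.d. rewards (`Bandit.sampleMean_eq`). An error requires one
  of them to be off by `d / 2`, which by Markov's inequality for `p`-th moments has a probability of
  order `(t ^ α) ^ (-e) = t ^ (α - 1)`, where `e = p - 1` for `p ≤ 2`, `e = p / 2` for `p > 2`, and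
  `α = 1 / (1 + e)` (`Bandit.measureReal_le_abs_mean_sub`). Summation over `t` gives `T ^ α`.

The moment bounds for a sum `S` of independent centred variables `Y i` come from one identity
(`integral_abs_sum_rpow_eq`): with `g x = sgn(x) |x| ^ (p - 1)`,
`E |S| ^ p = ∑ E [Y i g(S)] = ∑ E [Y i (g(S) - g(S - Y i))]`.
For `p ≤ 2` the Hölder continuity of `g` bounds this by `2 ∑ E |Y i| ^ p`. For `p > 2` the increment
is at most `(p - 1) |Y i| (|S| ^ (p - 2) + |S - Y i| ^ (p - 2))`; then Hölder's inequality and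
`E |S - Y i| ^ p ≤ E |S| ^ p` give an inequality for `E |S| ^ p` that can be solved. The resulting
constants `2` and `(2 (p - 1)) ^ (p / 2)` are below `(3 √2) ^ p p ^ (p / 2) = (18 p) ^ (p / 2)`.
-/

/-! ### The odd extension of the power function -/

/-- The odd extension `x ↦ sgn(x) |x| ^ q` of `x ↦ x ^ q` to the real line. For `q = p - 1` it is
the derivative of `|x| ^ p / p`. -/
noncomputable def signedPow (q x : ℝ) : ℝ := if 0 ≤ x then x ^ q else -(-x) ^ q

lemma measurable_signedPow (q : ℝ) : Measurable (signedPow q) := by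
  unfold signedPow
  exact Measurable.ite measurableSet_Ici (by fun_prop) (by fun_prop)

lemma signedPow_of_nonneg {q x : ℝ} (hx : 0 ≤ x) : signedPow q x = x ^ q := if_pos hx

lemma signedPow_neg {q : ℝ} (hq : q ≠ 0) (x : ℝ) : signedPow q (-x) = -signedPow q x := by
  unfold signedPow
  rcases lt_trichotomy x 0 with h | h | h
  · rw [if_pos (by linarith), if_neg (by linarith), neg_neg]
  · simp [h, Real.zero_rpow hq]
  · rw [if_neg (by linarith), if_pos h.le, neg_neg]

lemma abs_signedPow (q x : ℝ) : |signedPow q x| = |x| ^ q := by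
  unfold signedPow
  split_ifs with h
  · rw [abs_of_nonneg (Real.rpow_nonneg h q), abs_of_nonneg h]
  · rw [abs_neg, abs_of_neg (not_le.1 h), abs_of_nonneg (Real.rpow_nonneg (by linarith) q)]

lemma mul_signedPow_self {p : ℝ} (hp : 1 < p) (x : ℝ) : x * signedPow (p - 1) x = |x| ^ p := by
  have key : ∀ y : ℝ, 0 ≤ y → y * y ^ (p - 1) = y ^ p := fun y hy => by
    conv_lhs => rw [← Real.rpow_one y, ← Real.rpow_mul hy, one_mul]
    rw [← Real.rpow_add' hy (by linarith)]; ring_nf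
  rcases le_total 0 x with h | h
  · rw [signedPow_of_nonneg h, abs_of_nonneg h, key x h]
  · have e : signedPow (p - 1) x = -(-x) ^ (p - 1) := by
      rw [← signedPow_of_nonneg (neg_nonneg.2 h), signedPow_neg (by linarith), neg_neg]
    rw [e, abs_of_nonpos h, ← key (-x) (by linarith), mul_neg, neg_mul]

/-- A bound for the increments of `signedPow q` that depends only on `|x|`, `|y|` and `|x - y|` has
to be checked only for two nonnegative arguments and for two arguments of opposite sign. -/
lemma abs_signedPow_sub_le_of {q : ℝ} (hq : 0 < q) {B : ℝ → ℝ → ℝ → ℝ}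
    (hB : ∀ a b c, B a b c = B b a c)
    (h1 : ∀ x y, 0 ≤ y → y ≤ x → x ^ q - y ^ q ≤ B x y (x - y))
    (h2 : ∀ x y, 0 ≤ x → 0 ≤ y → x ^ q + y ^ q ≤ B x y (x + y)) (x y : ℝ) :
    |signedPow q x - signedPow q y| ≤ B |x| |y| |x - y| := by
  have base : ∀ a b : ℝ, 0 ≤ b → b ≤ a → |signedPow q a - signedPow q b| ≤ B |a| |b| |a - b| := by
    intro a b hb hba
    have ha := hb.trans hba
    rw [signedPow_of_nonneg ha, signedPow_of_nonneg hb, abs_of_nonneg ha, abs_of_nonneg hb,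
      abs_of_nonneg (sub_nonneg.2 hba),
      abs_of_nonneg (sub_nonneg.2 (Real.rpow_le_rpow hb hba hq.le))]
    exact h1 a b hb hba
  have base' : ∀ a b : ℝ, 0 ≤ a → 0 ≤ b → |signedPow q a - signedPow q b| ≤ B |a| |b| |a - b| := by
    intro a b ha hb
    rcases le_total b a with h | h
    · exact base a b hb h
    · rw [abs_sub_comm, hB, abs_sub_comm a]; exact base b a ha h
  have opp : ∀ a b : ℝ, 0 ≤ a → 0 ≤ b →
      |signedPow q a - signedPow q (-b)| ≤ B |a| |-b| |a - -b| := by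
    intro a b ha hb
    rw [signedPow_neg hq.ne', sub_neg_eq_add, signedPow_of_nonneg ha, signedPow_of_nonneg hb,
      abs_neg, sub_neg_eq_add, abs_of_nonneg ha, abs_of_nonneg hb, abs_of_nonneg (add_nonneg ha hb),
      abs_of_nonneg (add_nonneg (Real.rpow_nonneg ha q) (Real.rpow_nonneg hb q))]
    exact h2 a b ha hb
  rcases le_total 0 x with hx | hx <;> rcases le_total 0 y with hy | hy
  · exact base' x y hx hy
  · simpa using opp x (-y) hx (by linarith)
  · have := opp y (-x) hy (by linarith)
    rw [abs_sub_comm, hB, abs_sub_comm x]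
    simpa using this
  · have := base' (-x) (-y) (by linarith) (by linarith)
    rw [signedPow_neg hq.ne', signedPow_neg hq.ne', neg_sub_neg, neg_sub_neg, abs_neg, abs_neg] at this
    rw [abs_sub_comm, abs_sub_comm x]; exact this

lemma abs_signedPow_sub_le_of_le_one {q : ℝ} (hq : 0 < q) (hq1 : q ≤ 1) (x y : ℝ) :
    |signedPow q x - signedPow q y| ≤ 2 * |x - y| ^ q := by
  refine abs_signedPow_sub_le_of hq (B := fun _ _ c => 2 * c ^ q) (fun _ _ _ => rfl) ?_ ?_ x y
  · intro x y hy hyx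
    have h := Real.rpow_add_le_add_rpow hy (sub_nonneg.2 hyx) hq.le hq1
    have h' := Real.rpow_nonneg (sub_nonneg.2 hyx) q
    rw [add_sub_cancel] at h
    linarith
  · intro x y hx hy
    have h := Real.rpow_le_rpow hx (by linarith : x ≤ x + y) hq.le
    have h' := Real.rpow_le_rpow hy (by linarith : y ≤ x + y) hq.le
    linarith

lemma abs_signedPow_sub_le_of_one_le {q : ℝ} (hq : 1 < q) (x y : ℝ) :
    |signedPow q x - signedPow q y| ≤ q * |x - y| * (|x| ^ (q - 1) + |y| ^ (q - 1)) := by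
  have hq0 : 0 < q := by linarith
  have split : ∀ z : ℝ, 0 ≤ z → z ^ q = z ^ (q - 1) * z := fun z hz => by
    rw [← Real.rpow_add_one' hz (by linarith), sub_add_cancel]
  refine abs_signedPow_sub_le_of hq0
    (B := fun a b c => q * c * (a ^ (q - 1) + b ^ (q - 1)))
    (fun a b c => by simp only [add_comm]) ?_ ?_ x y
  · intro x y hy hyx
    have hx := hy.trans hyx
    have h0 : 0 ≤ q * (x - y) * y ^ (q - 1) :=
      mul_nonneg (mul_nonneg hq0.le (sub_nonneg.2 hyx)) (Real.rpow_nonneg hy _)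
    -- Bernoulli's inequality for `y / x = 1 + (y - x) / x`.
    have key : x ^ q - y ^ q ≤ q * (x - y) * x ^ (q - 1) := by
      rcases hx.eq_or_lt with h | h
      · have hy0 : y = 0 := by linarith
        simp [← h, hy0]
      · have hb := one_add_mul_self_le_rpow_one_add (s := (y - x) / x)
          (by rw [le_div_iff₀ h]; linarith) hq.le
        have e : 1 + (y - x) / x = y / x := by field_simp; ring
        rw [e, Real.div_rpow hy hx, le_div_iff₀ (Real.rpow_pos_of_pos h q)] at hb
        have e2 : (1 + q * ((y - x) / x)) * x ^ q = x ^ q + q * (y - x) * x ^ (q - 1) := by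
          rw [split x hx]; field_simp
        rw [e2] at hb
        linarith
    linarith
  · intro x y hx hy
    have hx' := Real.rpow_nonneg hx (q - 1)
    have hy' := Real.rpow_nonneg hy (q - 1)
    rw [split x hx, split y hy]
    have h1 : 0 ≤ (q - 1) * ((x + y) * (x ^ (q - 1) + y ^ (q - 1))) := by
      apply mul_nonneg (by linarith); positivity
    nlinarith [mul_nonneg hx hy', mul_nonneg hy hx']

/-! ### Moments of sums of independent centred variables -/

lemma integrable_abs_rpow {Ω : Type*} [MeasurableSpace Ω] {μ : Measure Ω} {p : ℝ} (hp : 1 < p)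
    {Y : Ω → ℝ} (hY : MemLp Y (ENNReal.ofReal p) μ) : Integrable (fun ω => |Y ω| ^ p) μ := by
  have := hY.integrable_norm_rpow (by simp; linarith) (by simp)
  simpa [ENNReal.toReal_ofReal (by linarith : (0 : ℝ) ≤ p)] using this

lemma mul_rpow_sub_one_le {p a b : ℝ} (hp : 1 < p) (ha : 0 ≤ a) (hb : 0 ≤ b) :
    a * b ^ (p - 1) ≤ a ^ p / p + b ^ p * (1 - 1 / p) := by
  have h := Real.young_inequality_of_nonneg ha (Real.rpow_nonneg hb (p - 1))
    (Real.HolderConjugate.conjExponent hp)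
  rw [Real.conjExponent, ← Real.rpow_mul hb, mul_div_cancel₀ _ (by linarith : p - 1 ≠ 0)] at h
  refine h.trans (le_of_eq ?_)
  have : p ≠ 0 := by linarith
  field_simp

lemma integrable_mul_signedPow {Ω : Type*} [MeasurableSpace Ω] {μ : Measure Ω} {p : ℝ} (hp : 1 < p)
    {Y Z : Ω → ℝ} (hY : MemLp Y (ENNReal.ofReal p) μ) (hZ : MemLp Z (ENNReal.ofReal p) μ) :
    Integrable (fun ω => Y ω * signedPow (p - 1) (Z ω)) μ := by
  refine Integrable.mono' (((integrable_abs_rpow hp hY).div_const p).add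
    ((integrable_abs_rpow hp hZ).mul_const (1 - 1 / p)))
    (hY.1.mul ((measurable_signedPow _).comp_aemeasurable
      hZ.1.aemeasurable).aestronglyMeasurable) (ae_of_all _ fun ω => ?_)
  rw [Real.norm_eq_abs, abs_mul, abs_signedPow]
  exact mul_rpow_sub_one_le hp (abs_nonneg _) (abs_nonneg _)

lemma integral_mul_signedPow_eq_zero {Ω : Type*} [MeasurableSpace Ω] {μ : Measure Ω} {p : ℝ}
    {Y Z : Ω → ℝ} (hY : AEStronglyMeasurable Y μ)
    (hZ : AEStronglyMeasurable Z μ) (hind : IndepFun Z Y μ) (h0 : ∫ ω, Y ω ∂μ = 0) :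
    ∫ ω, Y ω * signedPow (p - 1) (Z ω) ∂μ = 0 := by
  have h := (hind.symm.comp measurable_id (measurable_signedPow (p - 1)))
  have := h.integral_fun_mul_eq_mul_integral hY
    ((measurable_signedPow _).comp_aemeasurable hZ.aemeasurable).aestronglyMeasurable
  simpa [h0] using this

/-- Adding an independent centred variable does not decrease the `p`-th absolute moment. -/
lemma integral_abs_rpow_le_add {Ω : Type*} [MeasurableSpace Ω] {μ : Measure Ω} {p : ℝ} (hp : 1 < p)
    {Y Z : Ω → ℝ} (hY : MemLp Y (ENNReal.ofReal p) μ) (hZ : MemLp Z (ENNReal.ofReal p) μ)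
    (hind : IndepFun Z Y μ) (h0 : ∫ ω, Y ω ∂μ = 0) :
    ∫ ω, |Z ω| ^ p ∂μ ≤ ∫ ω, |Z ω + Y ω| ^ p ∂μ := by
  have hp0 : 0 < p := by linarith
  have h1 : ∫ ω, |Z ω| ^ p ∂μ = ∫ ω, (Z ω + Y ω) * signedPow (p - 1) (Z ω) ∂μ := by
    simp_rw [add_mul]
    rw [integral_add (integrable_mul_signedPow hp hZ hZ) (integrable_mul_signedPow hp hY hZ),
      integral_mul_signedPow_eq_zero hY.1 hZ.1 hind h0, add_zero]
    simp_rw [mul_signedPow_self hp]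
  have i1 : Integrable (fun ω => |Z ω + Y ω| ^ p / p) μ :=
    (integrable_abs_rpow hp (hZ.add hY)).div_const p
  have i2 := (integrable_abs_rpow hp hZ).mul_const (1 - 1 / p)
  have h2 : ∫ ω, (Z ω + Y ω) * signedPow (p - 1) (Z ω) ∂μ ≤
      ∫ ω, (|Z ω + Y ω| ^ p / p + |Z ω| ^ p * (1 - 1 / p)) ∂μ := by
    refine integral_mono (integrable_mul_signedPow hp (hZ.add hY) hZ) (i1.add i2) fun ω => ?_
    refine (le_abs_self _).trans ?_
    rw [abs_mul, abs_signedPow]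
    exact mul_rpow_sub_one_le hp (abs_nonneg _) (abs_nonneg _)
  rw [← h1, integral_add i1 i2, integral_div, integral_mul_const] at h2
  rw [mul_sub, mul_one, mul_one_div] at h2
  have h3 : (∫ ω, |Z ω| ^ p ∂μ) / p ≤ (∫ ω, |Z ω + Y ω| ^ p ∂μ) / p := by linarith
  exact (div_le_div_iff_of_pos_right hp0).1 h3

section Sums

variable {Ω ι : Type*} [MeasurableSpace Ω] {μ : Measure Ω} [Fintype ι] {p : ℝ} {Y : ι → Ω → ℝ}

lemma indepFun_sum_sub (hm : ∀ i, Measurable (Y i)) (hind : iIndepFun Y μ) (i : ι) :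
    IndepFun (fun ω => ∑ j, Y j ω - Y i ω) (Y i) μ := by
  classical
  have h := hind.indepFun_finsetSum_of_notMem hm (Finset.notMem_erase i Finset.univ)
  convert h using 1
  ext ω
  rw [Finset.sum_apply, sub_eq_iff_eq_add, Finset.sum_erase_add _ _ (Finset.mem_univ i)]

/-- The `p`-th moment of a sum of independent centred variables, expressed by increments of
`signedPow (p - 1)`: since `Y i` is centred and independent of the sum of the others, subtracting
`signedPow (p - 1)` of that sum changes nothing. -/
lemma integral_abs_sum_rpow_eq (hp : 1 < p) (hm : ∀ i, Measurable (Y i)) (hind : iIndepFun Y μ)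
    (hY : ∀ i, MemLp (Y i) (ENNReal.ofReal p) μ) (h0 : ∀ i, ∫ ω, Y i ω ∂μ = 0) :
    ∫ ω, |∑ j, Y j ω| ^ p ∂μ = ∑ i, ∫ ω, Y i ω *
      (signedPow (p - 1) (∑ j, Y j ω) - signedPow (p - 1) (∑ j, Y j ω - Y i ω)) ∂μ := by
  have hS : MemLp (fun ω => ∑ j, Y j ω) (ENNReal.ofReal p) μ :=
    memLp_finsetSum _ fun i _ => hY i
  simp_rw [← mul_signedPow_self hp, Finset.sum_mul]
  rw [integral_finsetSum _ fun i _ => integrable_mul_signedPow hp (hY i) hS]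
  refine Finset.sum_congr rfl fun i _ => ?_
  have hD : MemLp (fun ω => ∑ j, Y j ω - Y i ω) (ENNReal.ofReal p) μ := hS.sub (hY i)
  simp_rw [mul_sub]
  rw [integral_sub (integrable_mul_signedPow hp (hY i) hS)
      (integrable_mul_signedPow hp (hY i) hD),
    integral_mul_signedPow_eq_zero (hY i).1 hD.1 (indepFun_sum_sub hm hind i) (h0 i),
    sub_zero]

/-- The von Bahr–Esseen inequality: `p`-th absolute moments, `1 < p ≤ 2`, are subadditive up to a
factor for sums of independent centred variables. -/
lemma integral_abs_sum_rpow_le_of_le_two (hp : 1 < p) (hp2 : p ≤ 2) (hm : ∀ i, Measurable (Y i))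
    (hind : iIndepFun Y μ) (hY : ∀ i, MemLp (Y i) (ENNReal.ofReal p) μ)
    (h0 : ∀ i, ∫ ω, Y i ω ∂μ = 0) :
    ∫ ω, |∑ j, Y j ω| ^ p ∂μ ≤ 2 * ∑ i, ∫ ω, |Y i ω| ^ p ∂μ := by
  have hS : MemLp (fun ω => ∑ j, Y j ω) (ENNReal.ofReal p) μ :=
    memLp_finsetSum _ fun i _ => hY i
  rw [integral_abs_sum_rpow_eq hp hm hind hY h0, Finset.mul_sum]
  refine Finset.sum_le_sum fun i _ => ?_
  rw [← integral_const_mul]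
  refine integral_mono ?_ ((integrable_abs_rpow hp (hY i)).const_mul 2) fun ω => ?_
  · simp_rw [mul_sub]
    exact (integrable_mul_signedPow hp (hY i) hS).sub
      (integrable_mul_signedPow hp (hY i) (hS.sub (hY i)))
  · refine (le_abs_self _).trans ?_
    have h := abs_signedPow_sub_le_of_le_one (q := p - 1) (by linarith) (by linarith)
      (∑ j, Y j ω) (∑ j, Y j ω - Y i ω)
    rw [sub_sub_cancel] at h
    rw [abs_mul]
    refine (mul_le_mul_of_nonneg_left h (abs_nonneg _)).trans (le_of_eq ?_)
    rw [mul_left_comm, ← Real.rpow_one_add' (abs_nonneg _) (by linarith)]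
    ring_nf

lemma memLp_abs_rpow {Z : Ω → ℝ} {r : ℝ} (hr : 0 < r)
    (hZ : MemLp Z (ENNReal.ofReal p) μ) :
    MemLp (fun ω => |Z ω| ^ r) (ENNReal.ofReal (p / r)) μ := by
  have := hZ.norm_rpow_div (ENNReal.ofReal r)
  rw [ENNReal.ofReal_div_of_pos hr]
  simpa [ENNReal.toReal_ofReal hr.le] using this

/-- Hölder's inequality with the exponents `p / 2` and `p / (p - 2)`. -/
lemma integral_sq_mul_rpow_le {Z W : Ω → ℝ} (hp : 2 < p) (hZ : MemLp Z (ENNReal.ofReal p) μ)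
    (hW : MemLp W (ENNReal.ofReal p) μ) :
    ∫ ω, |Z ω| ^ (2 : ℝ) * |W ω| ^ (p - 2) ∂μ ≤
      (∫ ω, |Z ω| ^ p ∂μ) ^ (2 / p) * (∫ ω, |W ω| ^ p ∂μ) ^ (1 - 2 / p) := by
  have hp0 : 0 < p := by linarith
  have hp2 : 0 < p - 2 := by linarith
  have hc : (p / 2).HolderConjugate (p / (p - 2)) := by
    rw [Real.holderConjugate_iff]
    refine ⟨by linarith, ?_⟩
    field_simp; ring
  have h := integral_mul_le_Lp_mul_Lq_of_nonneg hc
    (ae_of_all μ fun ω => Real.rpow_nonneg (abs_nonneg (Z ω)) 2)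
    (ae_of_all μ fun ω => Real.rpow_nonneg (abs_nonneg (W ω)) (p - 2))
    (memLp_abs_rpow two_pos hZ) (memLp_abs_rpow hp2 hW)
  simp_rw [← Real.rpow_mul (abs_nonneg _)] at h
  rw [mul_div_cancel₀ _ hp2.ne', mul_div_cancel₀ _ (two_ne_zero' ℝ)] at h
  convert h using 3
  · field_simp
  · field_simp

lemma integrable_sq_mul_rpow {Z W : Ω → ℝ} (hp : 2 < p) (hZ : MemLp Z (ENNReal.ofReal p) μ)
    (hW : MemLp W (ENNReal.ofReal p) μ) :
    Integrable (fun ω => |Z ω| ^ (2 : ℝ) * |W ω| ^ (p - 2)) μ := by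
  have hp0 : 0 < p := by linarith
  have hp2 : 0 < p - 2 := by linarith
  have hc : (p / 2).HolderConjugate (p / (p - 2)) := by
    rw [Real.holderConjugate_iff]
    refine ⟨by linarith, ?_⟩
    field_simp; ring
  have := hc.ennrealOfReal
  exact (memLp_abs_rpow two_pos hZ).integrable_mul (memLp_abs_rpow hp2 hW)

/-- A Marcinkiewicz–Zygmund-type bound for `p > 2` with equal `p`-th moments `m`. With `M` the moment of the
sum, the increment formula and Hölder's inequality give
`M ≤ 2 (p - 1) k m ^ (2 / p) M ^ (1 - 2 / p)`, which is solved for `M`. -/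
lemma integral_abs_sum_rpow_le_of_two_lt (hp : 2 < p) (hm : ∀ i, Measurable (Y i))
    (hind : iIndepFun Y μ) (hY : ∀ i, MemLp (Y i) (ENNReal.ofReal p) μ)
    (h0 : ∀ i, ∫ ω, Y i ω ∂μ = 0) {m : ℝ} (hmom : ∀ i, ∫ ω, |Y i ω| ^ p ∂μ = m) (hm0 : 0 ≤ m) :
    ∫ ω, |∑ j, Y j ω| ^ p ∂μ ≤ (2 * (p - 1) * Fintype.card ι) ^ (p / 2) * m := by
  have hp1 : 1 < p := by linarith
  have hp0 : 0 < p := by linarith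
  have hS : MemLp (fun ω => ∑ j, Y j ω) (ENNReal.ofReal p) μ :=
    memLp_finsetSum _ fun i _ => hY i
  set M := ∫ ω, |∑ j, Y j ω| ^ p ∂μ with hM
  have hM0 : 0 ≤ M := integral_nonneg fun ω => Real.rpow_nonneg (abs_nonneg _) _
  have hterm : ∀ i, ∫ ω, Y i ω *
      (signedPow (p - 1) (∑ j, Y j ω) - signedPow (p - 1) (∑ j, Y j ω - Y i ω)) ∂μ ≤
      2 * (p - 1) * (m ^ (2 / p) * M ^ (1 - 2 / p)) := by
    intro i
    have hD : MemLp (fun ω => ∑ j, Y j ω - Y i ω) (ENNReal.ofReal p) μ := hS.sub (hY i)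
    have hDM : ∫ ω, |∑ j, Y j ω - Y i ω| ^ p ∂μ ≤ M := by
      simpa using integral_abs_rpow_le_add hp1 (hY i) hD (indepFun_sum_sub hm hind i) (h0 i)
    have i1 := integrable_sq_mul_rpow hp (hY i) hS
    have i2 := integrable_sq_mul_rpow hp (hY i) hD
    have b1 := integral_sq_mul_rpow_le hp (hY i) hS
    have b2 := integral_sq_mul_rpow_le hp (hY i) hD
    have hexp : 0 ≤ 1 - 2 / p := by
      rw [sub_nonneg, div_le_one hp0]; exact hp.le
    have b3 : (∫ ω, |∑ j, Y j ω - Y i ω| ^ p ∂μ) ^ (1 - 2 / p) ≤ M ^ (1 - 2 / p) :=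
      Real.rpow_le_rpow (integral_nonneg fun ω => Real.rpow_nonneg (abs_nonneg _) _) hDM hexp
    rw [hmom i] at b1 b2
    have b2' := b2.trans (mul_le_mul_of_nonneg_left b3 (Real.rpow_nonneg hm0 (2 / p)))
    have hmono : ∫ ω, Y i ω *
        (signedPow (p - 1) (∑ j, Y j ω) - signedPow (p - 1) (∑ j, Y j ω - Y i ω)) ∂μ ≤
        ∫ ω, (p - 1) * (|Y i ω| ^ (2 : ℝ) * |∑ j, Y j ω| ^ (p - 2) +
          |Y i ω| ^ (2 : ℝ) * |∑ j, Y j ω - Y i ω| ^ (p - 2)) ∂μ := by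
      refine integral_mono ?_ ((i1.add i2).const_mul (p - 1)) fun ω => ?_
      · simp_rw [mul_sub]
        exact (integrable_mul_signedPow hp1 (hY i) hS).sub
          (integrable_mul_signedPow hp1 (hY i) hD)
      · refine (le_abs_self _).trans ?_
        have h := abs_signedPow_sub_le_of_one_le (q := p - 1) (by linarith)
          (∑ j, Y j ω) (∑ j, Y j ω - Y i ω)
        rw [sub_sub_cancel, show p - 1 - 1 = p - 2 by ring] at h
        rw [abs_mul]
        refine (mul_le_mul_of_nonneg_left h (abs_nonneg _)).trans (le_of_eq ?_)
        rw [Real.rpow_two]; ring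
    rw [integral_const_mul, integral_add i1 i2] at hmono
    refine hmono.trans ?_
    rw [mul_comm (2 : ℝ), mul_assoc]
    exact mul_le_mul_of_nonneg_left (by rw [two_mul]; exact add_le_add b1 b2') (by linarith)
  have hsum : M ≤ 2 * (p - 1) * Fintype.card ι * m ^ (2 / p) * M ^ (1 - 2 / p) := by
    refine (integral_abs_sum_rpow_eq hp1 hm hind hY h0).le.trans ?_
    refine (Finset.sum_le_sum fun i _ => hterm i).trans (le_of_eq ?_)
    rw [Finset.sum_const, Finset.card_univ, nsmul_eq_mul]; ring
  have hc : 0 ≤ 2 * (p - 1) * Fintype.card ι :=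
    mul_nonneg (by linarith) (Nat.cast_nonneg _)
  rcases hM0.eq_or_lt with h | h
  · rw [← h]; exact mul_nonneg (Real.rpow_nonneg hc _) hm0
  · have h2 : M ^ (2 / p) ≤ 2 * (p - 1) * Fintype.card ι * m ^ (2 / p) := by
      rw [Real.rpow_sub h, Real.rpow_one, mul_div_assoc', le_div_iff₀ (Real.rpow_pos_of_pos h _),
        mul_comm M] at hsum
      exact le_of_mul_le_mul_right hsum h
    have h3 := Real.rpow_le_rpow (Real.rpow_nonneg hM0 _) h2 (by positivity : 0 ≤ p / 2)
    have e : 2 / p * (p / 2) = 1 := by field_simp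
    rwa [Real.mul_rpow hc (Real.rpow_nonneg hm0 _), ← Real.rpow_mul hM0, ← Real.rpow_mul hm0, e,
      Real.rpow_one, Real.rpow_one] at h3

end Sums

namespace Bandit

/-! ### Concentration of sample means -/

/-- The decay exponent `e` of the deviation probabilities: the sample mean of `k` rewards deviates by
a fixed amount with probability `O(k ^ (-e))`. -/
def IsDecayExponent (p e : ℝ) : Prop := (p ≤ 2 ∧ e = p - 1) ∨ (2 < p ∧ e = p / 2)

lemma IsDecayExponent.pos {p e : ℝ} (hp : 1 < p) (he : IsDecayExponent p e) : 0 < e := by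
  rcases he with ⟨-, rfl⟩ | ⟨-, rfl⟩ <;> linarith

lemma two_le_momentConst {p : ℝ} (hp : 1 < p) : 2 ≤ (3 * √2) ^ p * p ^ (p / 2) := by
  have h2 : (1 : ℝ) ≤ √2 := by rw [Real.one_le_sqrt]; norm_num
  have h3 : (3 : ℝ) ≤ (3 * √2) ^ p := by
    calc (3 : ℝ) ≤ 3 * √2 := by linarith
      _ ≤ (3 * √2) ^ p := Real.self_le_rpow_of_one_le (by linarith) hp.le
  have h4 : 1 ≤ p ^ (p / 2) := Real.one_le_rpow hp.le (by linarith)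
  nlinarith

lemma momentConst_eq {p : ℝ} (hp : 1 < p) : (3 * √2) ^ p * p ^ (p / 2) = (18 * p) ^ (p / 2) := by
  have h18 : (18 : ℝ) = (3 * √2) ^ (2 : ℝ) := by
    rw [Real.rpow_two, mul_pow, Real.sq_sqrt (by norm_num)]; norm_num
  have h18' : (18 : ℝ) ^ (p / 2) = (3 * √2) ^ p := by
    rw [h18, ← Real.rpow_mul (by positivity), mul_div_cancel₀ _ (two_ne_zero' ℝ)]
  rw [Real.mul_rpow (x := 18) (by norm_num) (by linarith), h18']

section Rewards

variable {N : ℕ} {Ω : Type*} [MeasurableSpace Ω] {μ : Measure Ω} {ν : Fin N → Measure ℝ}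
  {X : Fin N → ℕ → Ω → ℝ} {p e : ℝ}

lemma IsRewardProcess.memLp (hX : IsRewardProcess μ ν X)
    (hmom : ∀ n, MemLp (fun x : ℝ => x) (ENNReal.ofReal p) (ν n)) (n : Fin N) {t : ℕ} (ht : 1 ≤ t) :
    MemLp (X n t) (ENNReal.ofReal p) μ := by
  have h := hmom n
  rw [← hX.law n t ht, memLp_map_measure_iff (by fun_prop) (hX.measurable n t ht).aemeasurable] at h
  exact h

lemma IsRewardProcess.integral_eq (hX : IsRewardProcess μ ν X) (n : Fin N) {t : ℕ} (ht : 1 ≤ t) :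
    ∫ ω, X n t ω ∂μ = armMean ν n := by
  rw [armMean, ← hX.law n t ht,
    integral_map (hX.measurable n t ht).aemeasurable (by fun_prop)]

lemma IsRewardProcess.integral_abs_sub_rpow (hX : IsRewardProcess μ ν X) (n : Fin N) {t : ℕ}
    (ht : 1 ≤ t) : ∫ ω, |X n t ω - armMean ν n| ^ p ∂μ = centralMomentAbs ν p n := by
  rw [centralMomentAbs]
  conv_rhs => rw [← hX.law n t ht]
  rw [integral_map (hX.measurable n t ht).aemeasurable]
  exact Measurable.aestronglyMeasurable (by fun_prop)

lemma centralMomentAbs_nonneg (ν : Fin N → Measure ℝ) (p : ℝ) (n : Fin N) :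
    0 ≤ centralMomentAbs ν p n :=
  integral_nonneg fun _ => Real.rpow_nonneg (abs_nonneg _) _

variable [IsProbabilityMeasure μ]

lemma integral_abs_sum_sub_rpow_le (hX : IsRewardProcess μ ν X) (hp : 1 < p)
    (he : IsDecayExponent p e)
    (hmom : ∀ n, MemLp (fun x : ℝ => x) (ENNReal.ofReal p) (ν n)) (n : Fin N) (E : Finset ℕ)
    (hE : ∀ s ∈ E, 1 ≤ s) :
    ∫ ω, |∑ s ∈ E, (X n s ω - armMean ν n)| ^ p ∂μ ≤
      (3 * √2) ^ p * p ^ (p / 2) * (E.card : ℝ) ^ (p - e) * centralMomentAbs ν p n := by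
  let Y : E → Ω → ℝ := fun s ω => X n s ω - armMean ν n
  have hm : ∀ i, Measurable (Y i) := fun i => (hX.measurable n i (hE i i.2)).sub_const _
  have hY : ∀ i, MemLp (Y i) (ENNReal.ofReal p) μ := fun i =>
    (hX.memLp hmom n (hE i i.2)).sub (memLp_const _)
  have h0 : ∀ i, ∫ ω, Y i ω ∂μ = 0 := fun i => by
    have hi : Integrable (X n i) μ := (hX.memLp hmom n (hE i i.2)).integrable
      (by rw [← ENNReal.ofReal_one]; exact ENNReal.ofReal_le_ofReal hp.le)
    rw [integral_sub hi (integrable_const _), hX.integral_eq n (hE i i.2)]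
    simp
  have hind : iIndepFun Y μ := by
    have h1 := hX.indep.precomp (g := fun s : E => (n, (⟨s, hE s s.2⟩ : ℕ+))) (by
      intro a b hab
      exact Subtype.ext (congrArg (fun q : Fin N × ℕ+ => (q.2 : ℕ)) hab))
    exact h1.comp (fun _ x => x - armMean ν n) (fun _ => by fun_prop)
  have hmm : ∀ i, ∫ ω, |Y i ω| ^ p ∂μ = centralMomentAbs ν p n := fun i =>
    hX.integral_abs_sub_rpow n (hE i i.2)
  have hm0 := centralMomentAbs_nonneg ν p n
  have hsum : ∀ ω, ∑ s ∈ E, (X n s ω - armMean ν n) = ∑ i, Y i ω := fun ω =>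
    (Finset.sum_coe_sort E fun s => X n s ω - armMean ν n).symm
  simp_rw [hsum]
  rcases he with ⟨h2, rfl⟩ | ⟨h2, rfl⟩
  · refine (integral_abs_sum_rpow_le_of_le_two hp h2 hm hind hY h0).trans ?_
    simp_rw [hmm]
    rw [Finset.sum_const, Finset.card_univ, Fintype.card_coe, nsmul_eq_mul, sub_sub_cancel,
      Real.rpow_one, ← mul_assoc]
    gcongr
    exact two_le_momentConst hp
  · refine (integral_abs_sum_rpow_le_of_two_lt h2 hm hind hY h0 hmm hm0).trans ?_
    rw [momentConst_eq hp, Fintype.card_coe, Real.mul_rpow (by linarith) (Nat.cast_nonneg _),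
      sub_half]
    gcongr
    · linarith
    · linarith

/-- Markov's inequality for the `p`-th absolute moment of the deviation of a sample mean. -/
lemma measureReal_le_abs_mean_sub (hX : IsRewardProcess μ ν X) (hp : 1 < p)
    (he : IsDecayExponent p e)
    (hmom : ∀ n, MemLp (fun x : ℝ => x) (ENNReal.ofReal p) (ν n)) (n : Fin N) {E : Finset ℕ}
    (hE : ∀ s ∈ E, 1 ≤ s) (hne : E.Nonempty) {c : ℝ} (hc : 0 < c) :
    μ.real {ω | c ≤ |(∑ s ∈ E, X n s ω) / (E.card : ℝ) - armMean ν n|} ≤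
      (3 * √2) ^ p * p ^ (p / 2) * (centralMomentAbs ν p n / c ^ p) * (E.card : ℝ) ^ (-e) := by
  have hk : (0 : ℝ) < E.card := by exact_mod_cast hne.card_pos
  have hp0 : 0 < p := by linarith
  have hset : {ω | c ≤ |(∑ s ∈ E, X n s ω) / (E.card : ℝ) - armMean ν n|} =
      {ω | ((E.card : ℝ) * c) ^ p ≤ |∑ s ∈ E, (X n s ω - armMean ν n)| ^ p} := by
    ext ω
    simp only [Set.mem_ofPred_eq]
    rw [Real.rpow_le_rpow_iff (by positivity) (abs_nonneg _) hp0, Finset.sum_sub_distrib,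
      Finset.sum_const, nsmul_eq_mul]
    rw [show (∑ s ∈ E, X n s ω) / (E.card : ℝ) - armMean ν n =
      (∑ s ∈ E, X n s ω - E.card * armMean ν n) / E.card by field_simp, abs_div, abs_of_pos hk,
      le_div_iff₀ hk, mul_comm c]
  have hint : Integrable (fun ω => |∑ s ∈ E, (X n s ω - armMean ν n)| ^ p) μ :=
    integrable_abs_rpow hp (memLp_finsetSum _ fun s hs =>
      (hX.memLp hmom n (hE s hs)).sub (memLp_const _))
  have hM := mul_meas_ge_le_integral_of_nonneg
    (ae_of_all μ fun ω => Real.rpow_nonneg (abs_nonneg (∑ s ∈ E, (X n s ω - armMean ν n))) p)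
    hint (((E.card : ℝ) * c) ^ p)
  rw [← hset] at hM
  have hM' := hM.trans (integral_abs_sum_sub_rpow_le hX hp he hmom n E hE)
  have hkc : 0 < ((E.card : ℝ) * c) ^ p := by positivity
  rw [mul_comm, ← le_div_iff₀ hkc] at hM'
  refine hM'.trans (le_of_eq ?_)
  rw [Real.mul_rpow hk.le hc.le, sub_eq_add_neg, Real.rpow_add hk]
  field_simp

end Rewards

/-! ### The exploration schedule -/

section Schedule

variable {N : ℕ} {A : Set ℕ} {v α : ℝ}

lemma explUpTo_zero (A : Set ℕ) : explUpTo A 0 = ∅ := by simp [explUpTo]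

lemma mem_explUpTo {t s : ℕ} : s ∈ explUpTo A t ↔ (1 ≤ s ∧ s ≤ t) ∧ s ∈ A := by
  simp [explUpTo]

open Classical in
lemma explUpTo_succ (A : Set ℕ) (t : ℕ) : explUpTo A (t + 1) =
    if t + 1 ∈ A then insert (t + 1) (explUpTo A t) else explUpTo A t := by
  have h : Finset.Icc 1 (t + 1) = insert (t + 1) (Finset.Icc 1 t) := by
    ext s; simp only [Finset.mem_Icc, Finset.mem_insert]; omega
  rw [explUpTo, h, Finset.filter_insert]
  rfl

lemma notMem_explUpTo (A : Set ℕ) (t : ℕ) : t + 1 ∉ explUpTo A t := by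
  simp [explUpTo]

lemma card_explUpTo_succ_of_mem {t : ℕ} (h : t + 1 ∈ A) :
    (explUpTo A (t + 1)).card = (explUpTo A t).card + 1 := by
  classical
  rw [explUpTo_succ, if_pos h, Finset.card_insert_of_notMem (notMem_explUpTo A t)]

lemma card_explUpTo_succ_of_notMem {t : ℕ} (h : t + 1 ∉ A) :
    (explUpTo A (t + 1)).card = (explUpTo A t).card := by
  classical
  rw [explUpTo_succ, if_neg h]

lemma card_explUpTo_le (hv : 0 < v) (hα : 0 ≤ α)
    (hA : IsExplorationSequence (fun t => v * (t : ℝ) ^ α) A) (T : ℕ) (hT : 1 ≤ T) :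
    ((explUpTo A T).card : ℝ) ≤ (⌈v * (T : ℝ) ^ α⌉ : ℝ) := by
  induction T, hT using Nat.le_induction with
  | base =>
    have h1 : (explUpTo A 1).card ≤ 1 := by
      refine (Finset.card_le_card (t := {1}) fun s hs => ?_).trans (by simp)
      have := (mem_explUpTo.1 hs).1
      exact Finset.mem_singleton.2 (by omega)
    have h2 : (1 : ℤ) ≤ ⌈v * ((1 : ℕ) : ℝ) ^ α⌉ := by
      rw [Int.one_le_ceil_iff]; simpa using hv
    exact_mod_cast (Nat.cast_le (α := ℤ).2 h1).trans h2
  | succ t ht ih =>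
    by_cases h : t + 1 ∈ A
    · have h1 := (hA (t + 1) (by omega)).1 h
      rw [Nat.add_sub_cancel] at h1
      have h2 : ((explUpTo A t).card : ℤ) < ⌈v * ((t + 1 : ℕ) : ℝ) ^ α⌉ := by
        rw [Int.lt_ceil]; exact_mod_cast h1
      rw [card_explUpTo_succ_of_mem h]
      exact_mod_cast Int.add_one_le_iff.2 h2
    · rw [card_explUpTo_succ_of_notMem h]
      refine ih.trans ?_
      have : v * (t : ℝ) ^ α ≤ v * ((t + 1 : ℕ) : ℝ) ^ α := by
        gcongr; simp
      exact_mod_cast Int.ceil_mono this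

/-- The times up to `t` at which the round-robin exploration plays arm `n`. -/
noncomputable def armExplUpTo (N : ℕ) (A : Set ℕ) (t n : ℕ) : Finset ℕ :=
  (explUpTo A t).filter fun s => ((explUpTo A s).card - 1) % N = n

lemma mem_armExplUpTo {t n s : ℕ} : s ∈ armExplUpTo N A t n ↔
    ((1 ≤ s ∧ s ≤ t) ∧ s ∈ A) ∧ ((explUpTo A s).card - 1) % N = n := by
  rw [armExplUpTo, Finset.mem_filter, mem_explUpTo]

lemma card_armExplUpTo (N : ℕ) (A : Set ℕ) (t n : ℕ) :
    (armExplUpTo N A t n).card = Nat.count (fun j => j % N = n) (explUpTo A t).card := by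
  classical
  induction t with
  | zero => simp [armExplUpTo, explUpTo_zero]
  | succ t ih =>
    by_cases h : t + 1 ∈ A
    · rw [card_explUpTo_succ_of_mem h, Nat.count_succ, ← ih, armExplUpTo, explUpTo_succ, if_pos h,
        Finset.filter_insert, card_explUpTo_succ_of_mem h, Nat.add_sub_cancel]
      split_ifs with h'
      · rw [Finset.card_insert_of_notMem
          fun hm => notMem_explUpTo A t (Finset.mem_filter.1 hm).1]
        rfl
      · rfl
    · rw [card_explUpTo_succ_of_notMem h, ← ih, armExplUpTo, explUpTo_succ, if_neg h]
      rfl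

lemma div_le_card_armExplUpTo (A : Set ℕ) (t : ℕ) (n : Fin N) :
    (explUpTo A t).card / N ≤ (armExplUpTo N A t n).card := by
  have hN : 0 < N := n.pos
  have h := Nat.count_modEq_card (explUpTo A t).card hN n
  have e : (fun x => x ≡ (n : ℕ) [MOD N]) = fun j => j % N = n := by
    ext j; rw [Nat.ModEq, Nat.mod_eq_of_lt n.2]
  rw [card_armExplUpTo]
  simp only [e] at h
  omega

/-- At an exploitation time `t` with `v t ^ α ≥ N`, every arm has been explored at least
`v t ^ α / (2 N)` times. -/
lemma le_card_armExplUpTo (hA : IsExplorationSequence (fun t => v * (t : ℝ) ^ α) A) {t : ℕ}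
    (ht : 1 < t) (htA : t ∉ A) (hN : (N : ℝ) ≤ v * (t : ℝ) ^ α) (n : Fin N) :
    v * (t : ℝ) ^ α / (2 * N) ≤ (armExplUpTo N A (t - 1) n).card := by
  have h1 : v * (t : ℝ) ^ α ≤ (explUpTo A (t - 1)).card :=
    not_lt.1 fun h => htA ((hA t ht).2 h)
  have hpos : 0 < N := n.pos
  have h2 : N ≤ (explUpTo A (t - 1)).card := by exact_mod_cast hN.trans h1
  -- `⌊x⌋ ≥ x / 2` for `x ≥ 1`.
  have h3 : (explUpTo A (t - 1)).card ≤ (explUpTo A (t - 1)).card / N * (2 * N) := by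
    have a1 : 1 ≤ (explUpTo A (t - 1)).card / N := (Nat.one_le_div_iff hpos).2 h2
    have a2 := Nat.div_add_mod (explUpTo A (t - 1)).card N
    have a3 := Nat.mod_lt (explUpTo A (t - 1)).card hpos
    nlinarith
  have h4 := h3.trans (Nat.mul_le_mul_right (2 * N) (div_le_card_armExplUpTo A (t - 1) n))
  rw [div_le_iff₀ (by positivity)]
  exact h1.trans (by exact_mod_cast h4)

/-- On the history produced by a DSEE policy, the observations entering the sample means at time `t`
were made at times that do not depend on the rewards. -/
lemma map_explTimes_eq {π : Policy N} (hπ : π.IsDSEE A) (x : Fin N → ℕ → ℝ) (t : ℕ) (n : Fin N) :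
    (explTimes A (fun s : Finset.Ico 1 t => (π.arm x s, x (π.arm x s) s)) n).map
      (Function.Embedding.subtype _) = armExplUpTo N A (t - 1) n := by
  classical
  have harm : ∀ s, 1 ≤ s → s ∈ A →
      (π.arm x s = n ↔ ((explUpTo A s).card - 1) % N = n) := fun s hs hsA => by
    rw [Fin.ext_iff, Policy.arm, hπ.explore s hs hsA]
  ext s
  rw [mem_armExplUpTo]
  simp only [explTimes, Finset.mem_map, Finset.mem_filter, Finset.mem_univ, true_and,
    Function.Embedding.subtype_apply]
  constructor
  · rintro ⟨⟨s, hs⟩, ⟨hsA, hsn⟩, rfl⟩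
    have hs' := Finset.mem_Ico.1 hs
    exact ⟨⟨⟨hs'.1, Nat.le_pred_of_lt hs'.2⟩, hsA⟩, (harm s hs'.1 hsA).1 hsn⟩
  · rintro ⟨⟨⟨hs1, hs2⟩, hsA⟩, hsn⟩
    exact ⟨⟨s, Finset.mem_Ico.2 ⟨hs1, by omega⟩⟩, ⟨hsA, (harm s hs1 hsA).2 hsn⟩, rfl⟩

lemma sampleMean_eq {π : Policy N} (hπ : π.IsDSEE A) (x : Fin N → ℕ → ℝ) (t : ℕ) (n : Fin N) :
    sampleMean A (fun s : Finset.Ico 1 t => (π.arm x s, x (π.arm x s) s)) n =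
      (∑ s ∈ armExplUpTo N A (t - 1) n, x n s) / ((armExplUpTo N A (t - 1) n).card : ℝ) := by
  classical
  rw [sampleMean, ← map_explTimes_eq hπ x t n, Finset.card_map, Finset.sum_map]
  congr 1
  refine Finset.sum_congr rfl fun s hs => ?_
  have : π.arm x s = n := (Finset.mem_filter.1 hs).2.2
  simp [this]

lemma mean_le_of_exploit {π : Policy N} (hπ : π.IsDSEE A) (x : Fin N → ℕ → ℝ) {t : ℕ}
    (ht : 1 ≤ t) (htA : t ∉ A) (hne : ∀ n : Fin N, (armExplUpTo N A (t - 1) n).Nonempty)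
    (m : Fin N) :
    (∑ s ∈ armExplUpTo N A (t - 1) m, x m s) / ((armExplUpTo N A (t - 1) m).card : ℝ) ≤
      (∑ s ∈ armExplUpTo N A (t - 1) (π.arm x t), x (π.arm x t) s) /
        ((armExplUpTo N A (t - 1) (π.arm x t)).card : ℝ) := by
  have h := hπ.exploit t ht htA (fun s : Finset.Ico 1 t => (π.arm x s, x (π.arm x s) s))
    (fun n => by rw [← Finset.map_nonempty, map_explTimes_eq hπ]; exact hne n) m
  rw [← Policy.arm.eq_1, sampleMean_eq hπ, sampleMean_eq hπ] at h
  exact h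

end Schedule

/-! ### Regret as a sum of expected gaps -/

section Policy

variable {N : ℕ} (π : Policy N)

lemma Policy.arm_congr {x y : Fin N → ℕ → ℝ} (t : ℕ)
    (h : ∀ n s, 1 ≤ s → s < t → x n s = y n s) : π.arm x t = π.arm y t := by
  induction t using Nat.strong_induction_on with
  | _ t ih =>
    rw [Policy.arm, Policy.arm]
    congr 1
    ext s : 1
    have hs := Finset.mem_Ico.1 s.2
    have e := ih s hs.2 fun n r hr hrs => h n r hr (hrs.trans hs.2)
    rw [e, h _ s hs.1 hs.2]

lemma Policy.measurable_arm {Z : Type*} [MeasurableSpace Z] {x : Z → Fin N → ℕ → ℝ}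
    (hx : ∀ n s, 1 ≤ s → Measurable fun z => x z n s) (t : ℕ) :
    Measurable fun z => π.arm (x z) t := by
  induction t using Nat.strong_induction_on with
  | _ t ih =>
    have e : (fun z => π.arm (x z) t) = fun z => π.act t fun s : Finset.Ico 1 t =>
        (π.arm (x z) s, x z (π.arm (x z) s) s) := by
      ext z : 1; rw [Policy.arm]
    rw [e]
    refine (π.measurable_act t).comp (measurable_pi_lambda _ fun s => ?_)
    have hs := Finset.mem_Ico.1 s.2
    have harm := ih s hs.2
    refine harm.prodMk ?_
    have hF : Measurable (fun q : Fin N × Z => x q.2 q.1 s) :=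
      measurable_from_prod_countable_right fun n => hx n s hs.1
    exact hF.comp (harm.prodMk measurable_id)

variable {Ω : Type*} [MeasurableSpace Ω] {μ : Measure Ω} {ν : Fin N → Measure ℝ}
  {X : Fin N → ℕ → Ω → ℝ}

/-- The arm played at time `t` depends on the rewards before time `t` only. -/
lemma indepFun_arm (hX : IsRewardProcess μ ν X) (n : Fin N) {t : ℕ} (ht : 1 ≤ t) :
    IndepFun (fun ω => π.arm (fun n s => X n s ω) t) (X n t) μ := by
  let S : Finset (Fin N × ℕ+) := Finset.univ ×ˢ Finset.Ico 1 ⟨t, ht⟩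
  let R : Finset (Fin N × ℕ+) := {(n, ⟨t, ht⟩)}
  have hdis : Disjoint S R := by
    rw [Finset.disjoint_singleton_right, Finset.mem_product, not_and]
    exact fun _ hm => (Finset.mem_Ico.1 hm).2.false
  have h := hX.indep.indepFun_finset S R hdis fun q => hX.measurable q.1 q.2 q.2.2
  let tab : (S → ℝ) → Fin N → ℕ → ℝ := fun r m s =>
    if hs : 0 < s ∧ s < t then
      r ⟨(m, ⟨s, hs.1⟩), Finset.mem_product.2
        ⟨Finset.mem_univ _, Finset.mem_Ico.2 ⟨one_le, hs.2⟩⟩⟩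
    else 0
  have htab : ∀ m s, 1 ≤ s → Measurable fun r => tab r m s := fun m s _ => by
    by_cases hs : 0 < s ∧ s < t
    · simp only [tab, dif_pos hs]; exact measurable_pi_apply _
    · simp only [tab, dif_neg hs]; exact measurable_const
  have h2 := h.comp (π.measurable_arm htab t)
    (measurable_pi_apply (⟨(n, ⟨t, ht⟩), Finset.mem_singleton_self _⟩ : R))
  have e : (fun ω => π.arm (fun n s => X n s ω) t) =
      (fun r => π.arm (tab r) t) ∘ fun ω (i : S) => X i.1.1 (i.1.2 : ℕ) ω := by
    ext ω : 1
    refine π.arm_congr t fun m s hs hst => ?_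
    simp only [tab, dif_pos (⟨hs, hst⟩ : 0 < s ∧ s < t)]
    rfl
  rw [e]
  exact h2

lemma measurable_arm_comp (hX : IsRewardProcess μ ν X) (t : ℕ) :
    Measurable fun ω => π.arm (fun n s => X n s ω) t :=
  π.measurable_arm hX.measurable t

variable [IsProbabilityMeasure μ]

lemma integrable_comp_arm (hX : IsRewardProcess μ ν X) (f : Fin N → ℝ) (t : ℕ) :
    Integrable (fun ω => f (π.arm (fun n s => X n s ω) t)) μ := by
  refine Integrable.of_finite.comp_measurable (measurable_arm_comp π hX t)

lemma integral_reward_arm (hX : IsRewardProcess μ ν X) (hint : ∀ n, Integrable (fun x : ℝ => x) (ν n))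
    {t : ℕ} (ht : 1 ≤ t) :
    Integrable (fun ω => X (π.arm (fun n s => X n s ω) t) t ω) μ ∧
    ∫ ω, X (π.arm (fun n s => X n s ω) t) t ω ∂μ =
      ∫ ω, armMean ν (π.arm (fun n s => X n s ω) t) ∂μ := by
  classical
  let φ : Fin N → Fin N → ℝ := fun n a => if a = n then 1 else 0
  have hexp : ∀ (f : Fin N → ℝ) (a : Fin N), f a = ∑ n, φ n a * f n := fun f a => by
    simp [φ]
  have hXint : ∀ n, Integrable (X n t) μ := fun n => by
    have h := hint n
    rw [← hX.law n t ht, integrable_map_measure (by fun_prop)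
      (hX.measurable n t ht).aemeasurable] at h
    exact h
  have hφ := fun n => integrable_comp_arm π hX (φ n) t
  have hind : ∀ n, IndepFun (fun ω => φ n (π.arm (fun n s => X n s ω) t)) (X n t) μ := fun n =>
    (indepFun_arm π hX n ht).comp (measurable_of_finite (φ n)) measurable_id
  have hmul : ∀ n, Integrable
      (fun ω => φ n (π.arm (fun n s => X n s ω) t) * X n t ω) μ := fun n =>
    (hind n).integrable_mul (hφ n) (hXint n)
  have e1 : (fun ω => X (π.arm (fun n s => X n s ω) t) t ω) =
      fun ω => ∑ n, φ n (π.arm (fun n s => X n s ω) t) * X n t ω := by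
    ext ω; exact hexp (fun n => X n t ω) _
  have e2 : (fun ω => armMean ν (π.arm (fun n s => X n s ω) t)) =
      fun ω => ∑ n, φ n (π.arm (fun n s => X n s ω) t) * armMean ν n := by
    ext ω; exact hexp (armMean ν) _
  rw [e1, e2]
  refine ⟨integrable_finsetSum _ fun n _ => hmul n, ?_⟩
  rw [integral_finsetSum _ fun n _ => hmul n,
    integral_finsetSum _ fun n _ => (hφ n).mul_const _]
  refine Finset.sum_congr rfl fun n _ => ?_
  rw [(hind n).integral_fun_mul_eq_mul_integral (hφ n).1 (hXint n).1, integral_mul_const,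
    hX.integral_eq n ht]

/-- By the independence of past and present rewards, the regret is the sum over time of the expected
gaps of the arms played. -/
lemma regret_eq_sum_integral_gap (hX : IsRewardProcess μ ν X)
    (hint : ∀ n, Integrable (fun x : ℝ => x) (ν n)) (T : ℕ) :
    regret μ ν X π T =
      ∑ t ∈ Finset.Icc 1 T, ∫ ω, gap ν (π.arm (fun n s => X n s ω) t) ∂μ := by
  rw [regret, integral_finsetSum _ fun t ht =>
    (integral_reward_arm π hX hint (Finset.mem_Icc.1 ht).1).1]
  have h : ∀ t ∈ Finset.Icc 1 T, ∫ ω, gap ν (π.arm (fun n s => X n s ω) t) ∂μ =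
      bestMean ν - ∫ ω, X (π.arm (fun n s => X n s ω) t) t ω ∂μ := fun t ht => by
    rw [(integral_reward_arm π hX hint (Finset.mem_Icc.1 ht).1).2]
    simp only [gap]
    rw [integral_sub (integrable_const _) (integrable_comp_arm π hX (armMean ν) t)]
    simp
  rw [Finset.sum_congr rfl h, Finset.sum_sub_distrib]
  simp

end Policy

/-! ### Gaps -/

section Gap

variable {N : ℕ} (ν : Fin N → Measure ℝ)

lemma armMean_le_bestMean (n : Fin N) : armMean ν n ≤ bestMean ν :=
  le_ciSup (Set.finite_range _).bddAbove n

lemma gap_nonneg (n : Fin N) : 0 ≤ gap ν n := sub_nonneg.2 (armMean_le_bestMean ν n)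

lemma gap_le_maxGap (n : Fin N) : gap ν n ≤ maxGap ν :=
  le_ciSup (Set.finite_range (gap ν)).bddAbove n

lemma maxGap_nonneg : 0 ≤ maxGap ν := Real.iSup_nonneg (gap_nonneg ν)

lemma exists_armMean_eq_bestMean (hN : 1 ≤ N) : ∃ b, armMean ν b = bestMean ν := by
  have : Nonempty (Fin N) := ⟨⟨0, hN⟩⟩
  exact exists_eq_ciSup_of_finite

lemma exists_pos_le_gap : ∃ d, 0 < d ∧ ∀ n, gap ν n = 0 ∨ d ≤ gap ν n := by
  classical
  rcases (Finset.univ.filter fun n => gap ν n ≠ 0).eq_empty_or_nonempty with h | h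
  · refine ⟨1, one_pos, fun n => Or.inl ?_⟩
    by_contra hn
    exact Finset.notMem_empty n (h ▸ Finset.mem_filter.2 ⟨Finset.mem_univ n, hn⟩)
  · obtain ⟨m, hm, hmin⟩ := Finset.exists_min_image _ (gap ν) h
    refine ⟨gap ν m, (gap_nonneg ν m).lt_of_ne' (Finset.mem_filter.1 hm).2, fun n => ?_⟩
    by_cases hn : gap ν n = 0
    · exact Or.inl hn
    · exact Or.inr (hmin n (Finset.mem_filter.2 ⟨Finset.mem_univ n, hn⟩))

end Gap

/-! ### Sums over time -/

/-- Comparison of the sum with the integral of `x ^ (α - 1)`. -/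
lemma sum_rpow_sub_one_le {α : ℝ} (hα : 0 < α) (hα1 : α ≤ 1) (T : ℕ) (hT : 1 ≤ T) :
    ∑ t ∈ Finset.Icc 1 T, (t : ℝ) ^ (α - 1) ≤ ((T : ℝ) ^ α - 1) / α + 1 := by
  induction T, hT using Nat.le_induction with
  | base => simp
  | succ t ht ih =>
    rw [Finset.sum_Icc_succ_top (by omega)]
    have hx : (0 : ℝ) < ((t + 1 : ℕ) : ℝ) := by positivity
    have ht1 : (t : ℝ) = ((t + 1 : ℕ) : ℝ) - 1 := by push_cast; ring
    have ht0 : (0 : ℝ) ≤ t := Nat.cast_nonneg t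
    generalize ((t + 1 : ℕ) : ℝ) = x at hx ht1 ⊢
    have hx1 : 1 ≤ x := by linarith
    -- Bernoulli's inequality for `(1 - 1 / x) ^ α`.
    have hb := rpow_one_add_le_one_add_mul_self (s := -(1 / x))
      (by rw [neg_le_neg_iff, div_le_one hx]; exact hx1) hα.le hα1
    have e : 1 + -(1 / x) = (t : ℝ) / x := by rw [ht1]; field_simp; ring
    rw [e, Real.div_rpow ht0 hx.le, div_le_iff₀ (Real.rpow_pos_of_pos hx _)] at hb
    have e2 : (1 + α * -(1 / x)) * x ^ α = x ^ α - α * x ^ (α - 1) := by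
      rw [Real.rpow_sub_one hx.ne']; field_simp; ring
    rw [e2] at hb
    have h3 : x ^ (α - 1) ≤ (x ^ α - 1) / α - ((t : ℝ) ^ α - 1) / α := by
      rw [← sub_div, le_div_iff₀ hα]; linarith
    linarith

lemma card_filter_eq_one_or_lt_le (T : ℕ) {y : ℝ} (hy : 0 ≤ y) :
    (((Finset.Icc 1 T).filter fun t : ℕ => t = 1 ∨ (t : ℝ) < y).card : ℝ) ≤ 1 + y := by
  have hsub : (Finset.Icc 1 T).filter (fun t : ℕ => t = 1 ∨ (t : ℝ) < y) ⊆
      insert 1 (Finset.Icc 1 ⌊y⌋₊) := by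
    intro t ht
    obtain ⟨ht1, ht2⟩ := Finset.mem_filter.1 ht
    rcases ht2 with h | h
    · exact Finset.mem_insert.2 (Or.inl h)
    · exact Finset.mem_insert_of_mem
        (Finset.mem_Icc.2 ⟨(Finset.mem_Icc.1 ht1).1, Nat.le_floor h.le⟩)
  have h1 := (Finset.card_le_card hsub).trans (Finset.card_insert_le _ _)
  rw [Nat.card_Icc, Nat.add_sub_cancel] at h1
  have h2 : (((Finset.Icc 1 T).filter fun t : ℕ => t = 1 ∨ (t : ℝ) < y).card : ℝ) ≤ ⌊y⌋₊ + 1 := by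
    exact_mod_cast h1
  linarith [Nat.floor_le hy]

/-! ### The regret of DSEE -/

section Regret

variable {N : ℕ} {Ω : Type*} [MeasurableSpace Ω] {μ : Measure Ω} [IsProbabilityMeasure μ]
  {ν : Fin N → Measure ℝ} {X : Fin N → ℕ → Ω → ℝ} {p e v d : ℝ} {A : Set ℕ} {π : Policy N}

/-- If an arm that is not optimal has the largest sample mean, then either its sample mean or that
of an optimal arm is off by at least half of the minimal gap. -/
lemma exists_le_abs_mean_sub (hN : 1 ≤ N)
    (hd : ∀ n, gap ν n = 0 ∨ d ≤ gap ν n) {m : Fin N → ℝ} {a : Fin N} (ha : ∀ n, m n ≤ m a)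
    (hgap : gap ν a ≠ 0) : ∃ n, d / 2 ≤ |m n - armMean ν n| := by
  obtain ⟨b, hb⟩ := exists_armMean_eq_bestMean ν hN
  have h1 := (hd a).resolve_left hgap
  rw [gap, ← hb] at h1
  by_contra! h
  have h2 := (abs_lt.1 (h a)).2
  have h3 := (abs_lt.1 (h b)).1
  linarith [ha b]

lemma integral_gap_le_of_exploit (hN : 1 ≤ N) (hX : IsRewardProcess μ ν X) (hp : 1 < p)
    (he : IsDecayExponent p e)
    (hmom : ∀ n, MemLp (fun x : ℝ => x) (ENNReal.ofReal p) (ν n)) (hv : 0 < v)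
    (hA : IsExplorationSequence (fun t => v * (t : ℝ) ^ (1 / (1 + e))) A) (hπ : π.IsDSEE A)
    (hd0 : 0 < d) (hd : ∀ n, gap ν n = 0 ∨ d ≤ gap ν n) {t : ℕ} (ht : 1 < t) (htA : t ∉ A)
    (htN : (N : ℝ) ≤ v * (t : ℝ) ^ (1 / (1 + e))) :
    ∫ ω, gap ν (π.arm (fun n s => X n s ω) t) ∂μ ≤
      maxGap ν * ((3 * √2) ^ p * p ^ (p / 2)) * ((∑ n, centralMomentAbs ν p n) / (d / 2) ^ p) *
        (2 * N / v) ^ e * (t : ℝ) ^ (1 / (1 + e) - 1) := by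
  have he0 := he.pos hp
  have ht0 : (0 : ℝ) < t := by exact_mod_cast (by omega : 0 < t)
  have hN0 : (0 : ℝ) < N := by exact_mod_cast hN
  have hd2 : 0 < d / 2 := by linarith
  set α := 1 / (1 + e) with hα
  set E : Fin N → Finset ℕ := fun n => armExplUpTo N A (t - 1) n with hE
  set K := (3 * √2) ^ p * p ^ (p / 2) with hK
  have hK0 : 0 ≤ K := by linarith [two_le_momentConst hp]
  have hk0 : 0 < v * (t : ℝ) ^ α / (2 * N) := by positivity
  have hcard : ∀ n, v * (t : ℝ) ^ α / (2 * N) ≤ (E n).card := fun n =>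
    le_card_armExplUpTo hA ht htA htN n
  have hne : ∀ n, (E n).Nonempty := fun n =>
    Finset.card_pos.1 (by exact_mod_cast hk0.trans_le (hcard n))
  have hE1 : ∀ n, ∀ s ∈ E n, 1 ≤ s := fun n s hs => (mem_armExplUpTo.1 hs).1.1.1
  let D : Fin N → Set Ω := fun n =>
    {ω | d / 2 ≤ |(∑ s ∈ E n, X n s ω) / ((E n).card : ℝ) - armMean ν n|}
  have hDm : ∀ n, MeasurableSet (D n) := fun n => by
    have hs : Measurable fun ω => ∑ s ∈ E n, X n s ω :=
      Finset.measurable_sum _ fun s hs => hX.measurable n s (hE1 n s hs)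
    exact measurableSet_le measurable_const (by fun_prop)
  have hpt : ∀ ω, gap ν (π.arm (fun n s => X n s ω) t) ≤
      ∑ n, maxGap ν * (D n).indicator (fun _ => (1 : ℝ)) ω := by
    intro ω
    have hterm : ∀ n, 0 ≤ maxGap ν * (D n).indicator (fun _ => (1 : ℝ)) ω := fun n =>
      mul_nonneg (maxGap_nonneg ν) (Set.indicator_nonneg (fun _ _ => zero_le_one) ω)
    by_cases hg : gap ν (π.arm (fun n s => X n s ω) t) = 0
    · rw [hg]; exact Finset.sum_nonneg fun n _ => hterm n
    · obtain ⟨n, hn⟩ := exists_le_abs_mean_sub hN hd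
        (mean_le_of_exploit hπ (fun n s => X n s ω) ht.le htA hne) hg
      refine (gap_le_maxGap ν _).trans (le_trans ?_
        (Finset.single_le_sum (fun n _ => hterm n) (Finset.mem_univ n)))
      rw [Set.indicator_of_mem (show ω ∈ D n from hn), mul_one]
  have hDi : ∀ n, Integrable (fun ω => maxGap ν * (D n).indicator (fun _ => (1 : ℝ)) ω) μ :=
    fun n => ((integrable_const _).indicator (hDm n)).const_mul _
  have hprob : ∀ n, μ.real (D n) ≤
      K * (centralMomentAbs ν p n / (d / 2) ^ p) * ((2 * N / v) ^ e * (t : ℝ) ^ (α - 1)) := by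
    intro n
    refine (measureReal_le_abs_mean_sub hX hp he hmom n (hE1 n) (hne n) hd2).trans ?_
    have hc := div_nonneg (centralMomentAbs_nonneg ν p n) (Real.rpow_nonneg hd2.le p)
    refine mul_le_mul_of_nonneg_left ?_ (mul_nonneg hK0 hc)
    refine (Real.rpow_le_rpow_of_nonpos hk0 (hcard n) (by linarith)).trans (le_of_eq ?_)
    -- `α e = 1 - α`
    have hαe : α - 1 = α * (-e) := by rw [hα]; field_simp; ring
    rw [hαe, Real.rpow_mul ht0.le, mul_comm v, mul_div_assoc,
      Real.mul_rpow (by positivity) (by positivity), mul_comm, ← inv_div,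
      Real.rpow_neg (inv_nonneg.2 (by positivity)), Real.inv_rpow (by positivity), inv_inv]
  calc ∫ ω, gap ν (π.arm (fun n s => X n s ω) t) ∂μ
      ≤ ∫ ω, ∑ n, maxGap ν * (D n).indicator (fun _ => (1 : ℝ)) ω ∂μ :=
        integral_mono (integrable_comp_arm π hX (gap ν) t)
          (integrable_finsetSum _ fun n _ => hDi n) hpt
    _ = ∑ n, maxGap ν * μ.real (D n) := by
        rw [integral_finsetSum _ fun n _ => hDi n]
        refine Finset.sum_congr rfl fun n _ => ?_
        rw [integral_const_mul, integral_indicator_const _ (hDm n), smul_eq_mul, mul_one]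
    _ ≤ ∑ n, maxGap ν * (K * (centralMomentAbs ν p n / (d / 2) ^ p) *
          ((2 * N / v) ^ e * (t : ℝ) ^ (α - 1))) :=
        Finset.sum_le_sum fun n _ => mul_le_mul_of_nonneg_left (hprob n) (maxGap_nonneg ν)
    _ = _ := by
        rw [← Finset.mul_sum, ← Finset.sum_mul, ← Finset.mul_sum, ← Finset.sum_div]
        ring

lemma integrable_id_of_memLp [∀ n, IsProbabilityMeasure (ν n)] (hp : 1 < p)
    (hmom : ∀ n, MemLp (fun x : ℝ => x) (ENNReal.ofReal p) (ν n)) (n : Fin N) :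
    Integrable (fun x : ℝ => x) (ν n) :=
  (hmom n).integrable (by rw [← ENNReal.ofReal_one]; exact ENNReal.ofReal_le_ofReal hp.le)

/-- The finite-horizon regret bound. The three summands account for the late exploitation times, for
the exploration times, and for the first time step together with the times at which some arm may
still lack observations. -/
theorem regret_le [∀ n, IsProbabilityMeasure (ν n)] (hN : 1 ≤ N) (hX : IsRewardProcess μ ν X)
    (hp : 1 < p) (he : IsDecayExponent p e)
    (hmom : ∀ n, MemLp (fun x : ℝ => x) (ENNReal.ofReal p) (ν n)) (hv : 0 < v)
    (hA : IsExplorationSequence (fun t => v * (t : ℝ) ^ (1 / (1 + e))) A) (hπ : π.IsDSEE A)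
    (hd0 : 0 < d) (hd : ∀ n, gap ν n = 0 ∨ d ≤ gap ν n) {T : ℕ} (hT : 1 ≤ T) :
    regret μ ν X π T ≤
      maxGap ν * ((3 * √2) ^ p * p ^ (p / 2)) * ((∑ n, centralMomentAbs ν p n) / (d / 2) ^ p) *
          (2 * N / v) ^ e * ((1 + e) * ((T : ℝ) ^ (1 / (1 + e)) - 1) + 1)
        + maxGap ν * (⌈v * (T : ℝ) ^ (1 / (1 + e))⌉ : ℝ)
        + maxGap ν * (1 + (N / v) ^ (1 + e)) := by
  classical
  have he0 := he.pos hp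
  have hα0 : 0 < 1 / (1 + e) := by positivity
  have hα1 : 1 / (1 + e) ≤ 1 := by rw [div_le_one (by positivity)]; linarith
  have hG := maxGap_nonneg ν
  set B := maxGap ν * ((3 * √2) ^ p * p ^ (p / 2)) *
    ((∑ n, centralMomentAbs ν p n) / (d / 2) ^ p) * (2 * N / v) ^ e with hB
  have hB0 : 0 ≤ B := by
    have := Finset.sum_nonneg fun n (_ : n ∈ Finset.univ) => centralMomentAbs_nonneg ν p n
    have : 0 < p := by linarith
    positivity
  have hstep : ∀ t ∈ Finset.Icc 1 T, ∫ ω, gap ν (π.arm (fun n s => X n s ω) t) ∂μ ≤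
      B * (t : ℝ) ^ (1 / (1 + e) - 1) + maxGap ν * (if t ∈ A then 1 else 0) +
        maxGap ν * (if t = 1 ∨ (t : ℝ) < (N / v) ^ (1 + e) then 1 else 0) := by
    intro t ht
    have h1 : 0 ≤ B * (t : ℝ) ^ (1 / (1 + e) - 1) :=
      mul_nonneg hB0 (Real.rpow_nonneg (Nat.cast_nonneg t) _)
    have htriv : ∫ ω, gap ν (π.arm (fun n s => X n s ω) t) ∂μ ≤ maxGap ν := by
      refine (integral_mono (integrable_comp_arm π hX (gap ν) t) (integrable_const (maxGap ν))
        fun ω => gap_le_maxGap ν _).trans (le_of_eq (by simp))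
    by_cases htA : t ∈ A
    · rw [if_pos htA]
      split_ifs <;> linarith
    by_cases htN : t = 1 ∨ (t : ℝ) < (N / v) ^ (1 + e)
    · rw [if_pos htN, if_neg htA]
      linarith
    · rw [if_neg htN, if_neg htA]
      obtain ⟨ht1, ht2⟩ := not_or.1 htN
      have ht3 : (N : ℝ) ≤ v * (t : ℝ) ^ (1 / (1 + e)) := by
        have := Real.rpow_le_rpow (by positivity) (not_lt.1 ht2) hα0.le
        rw [← Real.rpow_mul (by positivity), mul_one_div_cancel (by positivity), Real.rpow_one,
          div_le_iff₀ hv] at this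
        linarith
      have := integral_gap_le_of_exploit hN hX hp he hmom hv hA hπ hd0 hd
        (lt_of_le_of_ne (Finset.mem_Icc.1 ht).1 (Ne.symm ht1)) htA ht3
      linarith
  rw [regret_eq_sum_integral_gap π hX (integrable_id_of_memLp hp hmom)]
  refine (Finset.sum_le_sum hstep).trans ?_
  rw [Finset.sum_add_distrib, Finset.sum_add_distrib, ← Finset.mul_sum, ← Finset.mul_sum,
    ← Finset.mul_sum, Finset.sum_boole, Finset.sum_boole]
  have s1 := sum_rpow_sub_one_le hα0 hα1 T hT
  rw [div_div_eq_mul_div, div_one, mul_comm _ (1 + e)] at s1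
  have s2 := card_explUpTo_le hv hα0.le hA T hT
  have s3 := card_filter_eq_one_or_lt_le T (y := (N / v) ^ (1 + e)) (by positivity)
  have s2' : (((Finset.Icc 1 T).filter fun t => t ∈ A).card : ℝ) ≤
      (⌈v * (T : ℝ) ^ (1 / (1 + e))⌉ : ℝ) := by
    refine le_trans (le_of_eq ?_) s2
    rw [explUpTo]
  exact add_le_add (add_le_add (mul_le_mul_of_nonneg_left s1 hB0)
    (mul_le_mul_of_nonneg_left s2' hG)) (mul_le_mul_of_nonneg_left s3 hG)

lemma regret_nonneg (hX : IsRewardProcess μ ν X)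
    (hint : ∀ n, Integrable (fun x : ℝ => x) (ν n)) (T : ℕ) : 0 ≤ regret μ ν X π T := by
  rw [regret_eq_sum_integral_gap π hX hint]
  exact Finset.sum_nonneg fun t _ => integral_nonneg fun ω => gap_nonneg ν _

lemma regret_isBigO [∀ n, IsProbabilityMeasure (ν n)] (hN : 1 ≤ N) (hX : IsRewardProcess μ ν X)
    (hp : 1 < p) (he : IsDecayExponent p e)
    (hmom : ∀ n, MemLp (fun x : ℝ => x) (ENNReal.ofReal p) (ν n)) (hv : 0 < v)
    (hA : IsExplorationSequence (fun t => v * (t : ℝ) ^ (1 / (1 + e))) A) (hπ : π.IsDSEE A) :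
    (fun T : ℕ => regret μ ν X π T) =O[atTop] fun T : ℕ => (T : ℝ) ^ (1 / (1 + e)) := by
  obtain ⟨d, hd0, hd⟩ := exists_pos_le_gap ν
  have he0 := he.pos hp
  have hG := maxGap_nonneg ν
  set B := maxGap ν * ((3 * √2) ^ p * p ^ (p / 2)) *
    ((∑ n, centralMomentAbs ν p n) / (d / 2) ^ p) * (2 * N / v) ^ e with hB
  have hB0 : 0 ≤ B := by
    have := Finset.sum_nonneg fun n (_ : n ∈ Finset.univ) => centralMomentAbs_nonneg ν p n
    have : 0 < p := by linarith
    positivity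
  refine IsBigO.of_bound (B * (1 + e) + maxGap ν * (v + 1) + maxGap ν * (1 + (N / v) ^ (1 + e))) ?_
  filter_upwards [eventually_ge_atTop 1] with T hT
  have h := regret_le hN hX hp he hmom hv hA hπ hd0 hd hT
  rw [← hB] at h
  have hT1 : 1 ≤ (T : ℝ) ^ (1 / (1 + e)) :=
    Real.one_le_rpow (by exact_mod_cast hT) (by positivity)
  rw [Real.norm_of_nonneg (regret_nonneg hX (integrable_id_of_memLp hp hmom) T),
    Real.norm_of_nonneg (by linarith)]
  generalize (T : ℝ) ^ (1 / (1 + e)) = x at h hT1 ⊢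
  have hceil := (Int.ceil_lt_add_one (v * x)).le
  have b1 : B * ((1 + e) * (x - 1) + 1) ≤ B * (1 + e) * x := by
    rw [mul_assoc B]; exact mul_le_mul_of_nonneg_left (by linarith) hB0
  have b2 : maxGap ν * (⌈v * x⌉ : ℝ) ≤ maxGap ν * (v + 1) * x := by
    rw [mul_assoc]; exact mul_le_mul_of_nonneg_left (by linarith) hG
  have b3 : maxGap ν * (1 + (N / v) ^ (1 + e)) ≤ maxGap ν * (1 + (N / v) ^ (1 + e)) * x :=
    le_mul_of_one_le_right (by positivity) hT1
  rw [add_mul, add_mul]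
  linarith

end Regret

end Bandit

theorem theorem3 {N : ℕ} (hN : 1 ≤ N) {Ω : Type*} [MeasurableSpace Ω] (μ : Measure Ω)
    [IsProbabilityMeasure μ] (ν : Fin N → Measure ℝ) [∀ n, IsProbabilityMeasure (ν n)]
    (X : Fin N → ℕ → Ω → ℝ) (hX : Bandit.IsRewardProcess μ ν X)
    (p : ℝ) (hp : 1 < p) (hmom : ∀ n, MemLp (fun x : ℝ => x) (ENNReal.ofReal p) (ν n))
    (v : ℝ) (hv : 0 < v) (A : Set ℕ)
    (hA : Bandit.IsExplorationSequence (fun t => v * (t : ℝ) ^ Bandit.explExponent p) A)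
    (π : Bandit.Policy N) (hπ : π.IsDSEE A) :
    (p ≤ 2 →
      (fun T : ℕ => Bandit.regret μ ν X π T) =O[atTop] (fun T : ℕ => (T : ℝ) ^ (1 / p)) ∧
      ∀ T : ℕ, 1 ≤ T → ∀ d : ℝ, 0 < d → (∀ n, Bandit.gap ν n = 0 ∨ d ≤ Bandit.gap ν n) →
        Bandit.regret μ ν X π T ≤
          Bandit.maxGap ν * ((3 * √2) ^ p * p ^ (p / 2)) *
              ((∑ n, Bandit.centralMomentAbs ν p n) / (d / 2) ^ p) *
              (2 * N / v) ^ (p - 1) * (p * ((T : ℝ) ^ (1 / p) - 1) + 1)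
            + Bandit.maxGap ν * (⌈v * (T : ℝ) ^ (1 / p)⌉ : ℝ)
            + Bandit.maxGap ν * (1 + (N / v) ^ p)) ∧
    (2 < p →
      (fun T : ℕ => Bandit.regret μ ν X π T) =O[atTop] (fun T : ℕ => (T : ℝ) ^ (1 / (1 + p / 2))) ∧
      ∀ T : ℕ, 1 ≤ T → ∀ d : ℝ, 0 < d → (∀ n, Bandit.gap ν n = 0 ∨ d ≤ Bandit.gap ν n) →
        Bandit.regret μ ν X π T ≤
          Bandit.maxGap ν * ((3 * √2) ^ p * p ^ (p / 2)) *
              ((∑ n, Bandit.centralMomentAbs ν p n) / (d / 2) ^ p) *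
              (2 * N / v) ^ (p / 2) * ((1 + p / 2) * ((T : ℝ) ^ (1 / (1 + p / 2)) - 1) + 1)
            + Bandit.maxGap ν * (⌈v * (T : ℝ) ^ (1 / (1 + p / 2))⌉ : ℝ)
            + Bandit.maxGap ν * (1 + (N / v) ^ (1 + p / 2))) := by
  constructor
  · intro h2
    have he : Bandit.IsDecayExponent p (p - 1) := Or.inl ⟨h2, rfl⟩
    have e1 : 1 + (p - 1) = p := by ring
    rw [Bandit.explExponent, if_pos h2] at hA
    have hA' : Bandit.IsExplorationSequence (fun t => v * (t : ℝ) ^ (1 / (1 + (p - 1)))) A := by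
      rwa [e1]
    have hO := Bandit.regret_isBigO hN hX hp he hmom hv hA' hπ
    rw [e1] at hO
    refine ⟨hO, fun T hT d hd0 hd => ?_⟩
    have h := Bandit.regret_le hN hX hp he hmom hv hA' hπ hd0 hd hT
    rwa [e1] at h
  · intro h2
    have he : Bandit.IsDecayExponent p (p / 2) := Or.inr ⟨h2, rfl⟩
    rw [Bandit.explExponent, if_neg h2.not_ge] at hA
    exact ⟨Bandit.regret_isBigO hN hX hp he hmom hv hA hπ, fun T hT d hd0 hd =>
      Bandit.regret_le hN hX hp he hmom hv hA hπ hd0 hd hT⟩
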